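/- **Definitions.** Let $G$ be a compact (Hausdorff) abelian group with dual group $\Gamma$ and normalized Haar measure. For a continuous function $f:G\to\mathbb C$ let $\hat f(\gamma)=\int_G f\,\overline{\gamma}$ for $\gamma\in\Gamma$, and let $$[\![f]\!]=\mathbb E\,\Big\|\sum_{\gamma\in\Gamma}\varepsilon_\gamma\hat f(\gamma)\gamma\Big\|_\infty\in[0,\infty],$$ where $(\varepsilon_\gamma)_{\gamma\in\Gamma}$ are independent random variables with $\mathbb P(\varepsilon_\gamma=1)=\mathbb P(\varepsilon_\gamma=-1)=\frac12$, the series is taken in $L^2(G)$ (where it converges unconditionally for every choice of signs), and $\|\cdot\|_\infty$ is the $L^\infty(G)$ norm, equal to $\infty$ if the sum is not essentially bounded. For $1\le p<2$, a set $\Lambda\subset\Gamma$ is called *$p$-Rider* if there is a constant $\kappa>0$ such that $$\Big(\sum_{\gamma\in\Gamma}|\hat f(\gamma)|^p\Big)^{1/p}\le\kappa\,[\![f]\!]$$ for every continuous $f:G\to\mathbb C$ with $\hat f$ supported on $\Lambda$. **Theorem.** Let $m\ge 2$ and let $G_1,\dots,G_m$ be compact abelian groups with dual groups $\Gamma_1,\dots,\Gamma_m$.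 For $1\le j\le m$ let $1\le p_j<2$ and let $\Lambda_j\subset\Gamma_j$ be a $p_j$-Rider set. Define $p$ by $$\frac1p=\frac12+\frac1{2R},\qquad R=\sum_{k=1}^m\frac{p_k}{2-p_k}.$$ Then $1\le p<2$ and $\Lambda_1\times\cdots\times\Lambda_m$ is a $p$-Rider set in $\Gamma_1\times\cdots\times\Gamma_m$, the latter being identified with the dual group of $G_1\times\cdots\times G_m$ through $(\gamma_1,\dots,\gamma_m)(x_1,\dots,x_m)=\gamma_1(x_1)\cdots\gamma_m(x_m)$. -/

import Mathlib

open MeasureTheory Topology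
open scoped ENNReal

noncomputable section

namespace Rider

section Fourier

variable {G : Type*} [CommGroup G] [TopologicalSpace G] [IsTopologicalGroup G] [CompactSpace G]

/-- The Haar measure of total mass one on a compact group. -/
def haar (G : Type*) [CommGroup G] [TopologicalSpace G] [IsTopologicalGroup G] [CompactSpace G]
    [MeasurableSpace G] [BorelSpace G] : Measure G :=
  Measure.haarMeasure (⊤ : TopologicalSpace.PositiveCompacts G)

/-- A character `γ` of `G`, as a complex-valued continuous function on `G`. -/
def charFun (γ : PontryaginDual G) : C(G, ℂ) where
  toFun x := (γ x : ℂ)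
  continuous_toFun := continuous_subtype_val.comp (map_continuous γ)

/-- The law of a family of independent symmetric Bernoulli variables indexed by `ι`:
the product over `ι` of the uniform measures on a two-point set. -/
def signMeasure (ι : Type*) : Measure (ι → Bool) :=
  Measure.infinitePi fun _ : ι => (PMF.uniformOfFintype Bool).toMeasure

/-- The two points of `Bool`, read as the signs `1` and `-1`. -/
def sign (b : Bool) : ℂ := if b then 1 else -1

variable [MeasurableSpace G] [BorelSpace G]

instance : (haar G).IsHaarMeasure := Measure.isHaarMeasure_haarMeasure _

instance : IsProbabilityMeasure (haar G) :=
  ⟨by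
    have h := Measure.haarMeasure_self (K₀ := (⊤ : TopologicalSpace.PositiveCompacts G))
    rwa [TopologicalSpace.PositiveCompacts.coe_top] at h⟩

/-- The Fourier coefficient `∫ f(x) conj(γ(x)) dx` of a continuous function `f` on `G`. -/
def fourierCoeff (f : C(G, ℂ)) (γ : PontryaginDual G) : ℂ :=
  ∫ x, f x * star (charFun γ x) ∂(haar G)

/-- The `ℓ^p` norm (with values in `[0, ∞]`) of the Fourier transform of `f`. -/
def coeffNorm (p : ℝ) (f : C(G, ℂ)) : ℝ≥0∞ :=
  (∑' γ : PontryaginDual G, ‖fourierCoeff f γ‖ₑ ^ p) ^ (1 / p)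

/-- A character `γ` of `G`, as an element of `L²(G)`. -/
def charL2 (γ : PontryaginDual G) : Lp ℂ 2 (haar G) :=
  ContinuousMap.toLp 2 (haar G) ℂ (charFun γ)

/-- The randomized Fourier series `∑ ε_γ f̂(γ) γ` of `f`, for a choice `ε` of signs.
It converges unconditionally in `L²(G)`, see `summable_randomSeries`. -/
def randomSeries (f : C(G, ℂ)) (ε : PontryaginDual G → Bool) : Lp ℂ 2 (haar G) :=
  ∑' γ : PontryaginDual G, (sign (ε γ) * fourierCoeff f γ) • charL2 γ

/-- The norm `⟦f⟧`, the expectation over independent signs of the sup norm (in `[0, ∞]`) of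
`∑ ε_γ f̂(γ) γ`. The sup norm of an element of `L²(G)` is its essential supremum; on continuous
functions, in particular whenever only finitely many coefficients are nonzero, it is the
maximum of the modulus, because the Haar measure has full support. -/
def randomNorm (f : C(G, ℂ)) : ℝ≥0∞ :=
  ∫⁻ ε : PontryaginDual G → Bool, eLpNorm (randomSeries f ε) ∞ (haar G)
    ∂(signMeasure (PontryaginDual G))

theorem integral_charFun_eq_zero {γ : PontryaginDual G} (h : γ ≠ 1) :
    ∫ x, charFun γ x ∂(haar G) = 0 := by
  obtain ⟨a, ha⟩ : ∃ a, γ a ≠ 1 := by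
    by_contra hc
    push Not at hc
    exact h (PontryaginDual.ext hc)
  have h1 : ∫ x, charFun γ (a * x) ∂(haar G) = ∫ x, charFun γ x ∂(haar G) :=
    integral_mul_left_eq_self (fun x => charFun γ x) a
  have h2 : ∀ x, charFun γ (a * x) = (γ a : ℂ) * charFun γ x := by
    intro x
    simp [charFun]
  simp only [h2, integral_const_mul] at h1
  have h3 : ((γ a : ℂ) - 1) * ∫ x, charFun γ x ∂(haar G) = 0 := by
    rw [sub_mul, h1]; ring
  rcases mul_eq_zero.mp h3 with h4 | h4
  · exact absurd (Circle.ext (by simpa using sub_eq_zero.mp h4)) ha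
  · exact h4

theorem orthonormal_charL2 :
    Orthonormal ℂ (charL2 : PontryaginDual G → Lp ℂ 2 (haar G)) := by
  classical
  rw [orthonormal_iff_ite]
  intro γ δ
  have h1 : inner ℂ (charL2 γ) (charL2 δ) = ∫ x, charFun (γ⁻¹ * δ) x ∂(haar G) := by
    unfold charL2
    rw [ContinuousMap.inner_toLp]
    refine integral_congr_ae (Filter.Eventually.of_forall fun x => ?_)
    have h2 : charFun (γ⁻¹ * δ) x = (((γ x)⁻¹ * δ x : Circle) : ℂ) := rfl
    change _ = charFun (γ⁻¹ * δ) x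
    rw [h2, Circle.coe_mul, Circle.coe_inv_eq_conj, mul_comm]
    rfl
  rw [h1]
  split_ifs with h
  · subst h
    simp [charFun]
  · exact integral_charFun_eq_zero (fun hc => h (inv_mul_eq_one.mp hc))

theorem summable_randomSeries (f : C(G, ℂ)) (ε : PontryaginDual G → Bool) :
    Summable fun γ : PontryaginDual G => (sign (ε γ) * fourierCoeff f γ) • charL2 γ := by
  have hinner : ∀ γ : PontryaginDual G,
      inner ℂ (charL2 γ) (ContinuousMap.toLp 2 (haar G) ℂ f) = fourierCoeff f γ := by
    intro γ
    unfold charL2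
    rw [ContinuousMap.inner_toLp]
    rfl
  have hsq : Summable fun γ : PontryaginDual G => ‖fourierCoeff f γ‖ ^ 2 := by
    have := (orthonormal_charL2 (G := G)).inner_products_summable
      (x := ContinuousMap.toLp 2 (haar G) ℂ f)
    simpa only [hinner] using this
  have horth := (orthonormal_charL2 (G := G)).orthogonalFamily
  have := (horth.summable_iff_norm_sq_summable
    (fun γ => sign (ε γ) * fourierCoeff f γ)).2 (by
      refine hsq.congr fun γ => ?_
      rw [norm_mul]
      have : ‖sign (ε γ)‖ = 1 := by unfold sign; split_ifs <;> simp
      rw [this, one_mul])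
  simpa using this

end Fourier

/-- `Λ` is a `p`-Rider subset of the dual group of `G`: `1 ≤ p < 2` and there is a constant
`κ > 0` with `‖f̂‖_p ≤ κ ⟦f⟧` for every continuous `f` on `G` whose Fourier transform is
supported on `Λ`. The group `G` carries its Borel σ-algebra. -/
def IsRider {G : Type*} [CommGroup G] [TopologicalSpace G] [IsTopologicalGroup G]
    [CompactSpace G] (p : ℝ) (Λ : Set (PontryaginDual G)) : Prop :=
  letI : MeasurableSpace G := borel G
  haveI : BorelSpace G := ⟨rfl⟩
  1 ≤ p ∧ p < 2 ∧ ∃ κ : ℝ, 0 < κ ∧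
    ∀ f : C(G, ℂ), (∀ γ, γ ∉ Λ → fourierCoeff f γ = 0) →
      coeffNorm p f ≤ ENNReal.ofReal κ * randomNorm f

/-- The identification of the product of the dual groups of `G₁, …, G_m` with the dual group of
`G₁ × ⋯ × G_m`: the tuple `(γ₁, …, γ_m)` is the character `x ↦ γ₁(x₁) ⋯ γ_m(x_m)`. -/
def dualPi {ι : Type*} [Fintype ι] [DecidableEq ι] (G : ι → Type*) [∀ j, CommGroup (G j)]
    [∀ j, TopologicalSpace (G j)] :
    (∀ j, PontryaginDual (G j)) ≃* PontryaginDual (∀ j, G j) where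
  toFun γ :=
    ({ toFun := fun x => ∏ j, γ j (x j)
       map_one' := by simp
       map_mul' := fun x y => by simp [Finset.prod_mul_distrib]
       continuous_toFun := continuous_finsetProd _ fun j _ =>
         (map_continuous (γ j)).comp (continuous_apply j) } : (∀ j, G j) →ₜ* Circle)
  invFun χ j :=
    ({ toFun := fun x => χ (Pi.mulSingle j x)
       map_one' := by simp
       map_mul' := fun x y => by simp [Pi.mulSingle_mul]
       continuous_toFun := (map_continuous χ).comp (continuous_mulSingle j) } :
      G j →ₜ* Circle)
  left_inv γ := by
    funext j
    ext x
    change ((∏ i, γ i (Pi.mulSingle j x i) : Circle) : ℂ) = γ j x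
    rw [Finset.prod_eq_single j]
    · simp
    · intro i _ hi
      simp [Pi.mulSingle_eq_of_ne hi]
    · simp
  right_inv χ := by
    ext x
    change ((∏ j, χ (Pi.mulSingle j (x j)) : Circle) : ℂ) = χ x
    rw [← map_prod, Finset.univ_prod_mulSingle]
  map_mul' γ δ := by
    ext x
    change ((∏ j, (γ j (x j) * δ j (x j)) : Circle) : ℂ) =
      (((∏ j, γ j (x j)) * ∏ j, δ j (x j) : Circle) : ℂ)
    rw [Finset.prod_mul_distrib]

/-- The product set `Λ₁ × ⋯ × Λ_m`, as a subset of the dual group of `G₁ × ⋯ × G_m`. -/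
def prodSet {ι : Type*} [Fintype ι] [DecidableEq ι] {G : ι → Type*} [∀ j, CommGroup (G j)]
    [∀ j, TopologicalSpace (G j)] (Λ : ∀ j, Set (PontryaginDual (G j))) :
    Set (PontryaginDual (∀ j, G j)) :=
  dualPi G '' Set.univ.pi Λ

end Rider

end

/-! Let `f` have spectrum in the product set, let `a` be its Fourier transform, and let `π_j` be the
projection of the dual of the product onto the dual of `G j`. Randomize `f` by signs `ε_χ` and
restrict it to the factor `G j`. Characters in one fibre of `π_j` merge, so the restriction has
coefficients `g_ε(γ) = ∑_{π_j χ = γ} ε_χ a_χ` and spectrum in `Λ j`. Apply the Rider inequality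
there and average over `ε`: since the products `η_{π_j χ} ε_χ` are again independent signs, and
restriction does not increase the sup norm, the mean `ℓ^(p j)` norm of `g_ε` is at most `κ j ⟦f⟧`.
By Minkowski and Khintchine this mean is at least half the `ℓ^(p j)` norm, over `γ`, of the `ℓ²`
norms of `a` on the fibres (`ofReal_mixed_norm_le`).

The mixed-norm bounds, one per factor, combine by a weighted AM-GM inequality into an `ℓ^q` bound
with `q = 2R/(R+1)` (`sum_rpow_le_of_mixed_norms`). Everything is done on finite sets of characters;
passing to them costs nothing, because a truncated random series is the average of two sign choices
(`lintegral_sum_charFun_le_randomNorm`). -/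

noncomputable section

namespace Rider

/-! ### Random signs and Khintchine's inequality. -/

section Signs

variable {ι κ : Type*}

instance : IsProbabilityMeasure (signMeasure ι) := by
  unfold signMeasure; infer_instance

/-- Multiplication of a family of signs by the family `η`. -/
def flip (η ε : ι → Bool) : ι → Bool := fun i => ε i == η i

theorem sign_beq (a b : Bool) : sign (a == b) = sign a * sign b := by
  cases a <;> cases b <;> simp [sign]

theorem sign_flip (η ε : ι → Bool) (i : ι) : sign (flip η ε i) = sign (ε i) * sign (η i) :=
  sign_beq _ _

theorem measurePreserving_flip (η : ι → Bool) :
    MeasurePreserving (flip η) (signMeasure ι) (signMeasure ι) := by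
  have hm : ∀ i, Measurable fun b : Bool => b == η i := fun i => Measurable.of_discrete
  refine ⟨measurable_pi_lambda _ fun i => (hm i).comp (measurable_pi_apply i), ?_⟩
  have h := Measure.infinitePi_map_pi (X := fun _ : ι => Bool) (Y := fun _ : ι => Bool)
    (μ := fun _ : ι => (PMF.uniformOfFintype Bool).toMeasure)
    (f := fun i b => b == η i) hm
  have h2 : ∀ c : Bool, ((PMF.uniformOfFintype Bool).toMeasure).map (fun b : Bool => b == c) =
      (PMF.uniformOfFintype Bool).toMeasure := by
    intro c
    refine Measure.ext_of_singleton fun b => ?_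
    rw [Measure.map_apply Measurable.of_discrete (measurableSet_singleton _)]
    have : (fun b : Bool => b == c) ⁻¹' {b} = {b == c} := by
      ext x; cases x <;> cases b <;> cases c <;> simp
    rw [this, PMF.toMeasure_apply_singleton _ _ (measurableSet_singleton _),
      PMF.toMeasure_apply_singleton _ _ (measurableSet_singleton _)]
    simp
  simp only [h2] at h
  exact h

/-- A function of finitely many signs factors through a finite discrete space, which makes
measurability and integrability automatic even for uncountable `ι`. -/
theorem exists_eq_comp_restrict {E : Type*} {F : (ι → Bool) → E} {A : Finset ι}
    (h : DependsOn F A) : ∃ g : (A → Bool) → E, F = fun ε => g fun i => ε i := by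
  have : Nonempty E := ⟨F fun _ => true⟩
  obtain ⟨g, hg⟩ := dependsOn_iff_exists_comp.1 h
  exact ⟨g, hg⟩

theorem stronglyMeasurable_of_dependsOn {E : Type*} [TopologicalSpace E] {F : (ι → Bool) → E}
    {A : Finset ι} (h : DependsOn F A) : StronglyMeasurable F := by
  obtain ⟨g, rfl⟩ := exists_eq_comp_restrict h
  exact (StronglyMeasurable.of_discrete (f := g)).comp_measurable
    (measurable_pi_lambda _ fun i => measurable_pi_apply _)

theorem integrable_of_dependsOn {E : Type*} [NormedAddCommGroup E] {F : (ι → Bool) → E}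
    {A : Finset ι} (h : DependsOn F A) : Integrable F (signMeasure ι) := by
  have hm := stronglyMeasurable_of_dependsOn h
  obtain ⟨g, rfl⟩ := exists_eq_comp_restrict h
  obtain ⟨C, hC⟩ := (Set.finite_range fun x => ‖g x‖).bddAbove
  exact Integrable.of_bound hm.aestronglyMeasurable C
    (Filter.Eventually.of_forall fun ε => hC ⟨_, rfl⟩)

theorem dependsOn_sum_sign {E : Type*} [AddCommGroup E] [Module ℂ E] (A : Finset ι)
    (v : ι → E) : DependsOn (fun ε : ι → Bool => ∑ i ∈ A, sign (ε i) • v i) (A : Set ι) := by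
  intro ε ε' h
  exact Finset.sum_congr rfl fun i hi => by rw [h i hi]

theorem dependsOn_comp {α : ι → Type*} {β γ : Type*} {F : (∀ i, α i) → β} {s : Set ι}
    (g : β → γ) (h : DependsOn F s) : DependsOn (fun x => g (F x)) s :=
  fun _ _ hxy => congrArg g (h hxy)

theorem integrable_comp_sum_sign (A : Finset ι) (a : ι → ℂ) (φ : ℂ → ℝ) :
    Integrable (fun ε => φ (∑ i ∈ A, sign (ε i) • a i)) (signMeasure ι) :=
  integrable_of_dependsOn (dependsOn_comp φ (dependsOn_sum_sign A a))

/-- Averaging over the sign of a single term. -/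
theorem integral_sum_insert [DecidableEq ι] (A : Finset ι) {j : ι} (hj : j ∉ A) (a : ι → ℂ)
    (φ : ℂ → ℝ) :
    ∫ ε, φ (∑ i ∈ insert j A, sign (ε i) • a i) ∂(signMeasure ι) =
      ∫ ε, (φ ((∑ i ∈ A, sign (ε i) • a i) + a j) + φ ((∑ i ∈ A, sign (ε i) • a i) - a j)) / 2
        ∂(signMeasure ι) := by
  -- `true` is the sign `1`, so flipping by `η` reverses the sign at `j` and no other.
  set η : ι → Bool := Function.update (fun _ => true) j false
  have hi := integrable_comp_sum_sign (insert j A) a φ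
  have hi' : Integrable (fun ε => φ (∑ i ∈ insert j A, sign (flip η ε i) • a i)) (signMeasure ι) :=
    (measurePreserving_flip η).integrable_comp_of_integrable hi
  have h1 : ∫ ε, φ (∑ i ∈ insert j A, sign (flip η ε i) • a i) ∂(signMeasure ι) =
      ∫ ε, φ (∑ i ∈ insert j A, sign (ε i) • a i) ∂(signMeasure ι) := by
    have h := integral_map (μ := signMeasure ι) (measurePreserving_flip η).measurable.aemeasurable
      (f := fun ε => φ (∑ i ∈ insert j A, sign (ε i) • a i))
      (by rw [(measurePreserving_flip η).map_eq]; exact hi.aestronglyMeasurable)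
    rw [(measurePreserving_flip η).map_eq] at h
    exact h.symm
  have h2 : ∫ ε, φ (∑ i ∈ insert j A, sign (ε i) • a i) ∂(signMeasure ι) =
      (∫ ε, (φ (∑ i ∈ insert j A, sign (ε i) • a i) +
        φ (∑ i ∈ insert j A, sign (flip η ε i) • a i)) ∂(signMeasure ι)) / 2 := by
    rw [integral_add hi hi', h1]; ring
  rw [h2, ← integral_div]
  refine integral_congr_ae (Filter.Eventually.of_forall fun ε => ?_)
  have h3 : ∑ i ∈ A, sign (flip η ε i) • a i = ∑ i ∈ A, sign (ε i) • a i := by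
    refine Finset.sum_congr rfl fun i hi => ?_
    have : i ≠ j := fun h => hj (h ▸ hi)
    rw [sign_flip]
    simp [η, this, sign]
  simp only [Finset.sum_insert hj, h3]
  have h4 : sign (flip η ε j) = - sign (ε j) := by
    rw [sign_flip]; simp [η, sign]
  rw [h4]
  cases hε : ε j
  · simp [sign, sub_eq_add_neg, add_comm]
  · simp [sign, sub_eq_add_neg, add_comm]

theorem integral_norm_sq_sum_sign (A : Finset ι) (a : ι → ℂ) :
    ∫ ε, ‖∑ i ∈ A, sign (ε i) • a i‖ ^ 2 ∂(signMeasure ι) = ∑ i ∈ A, ‖a i‖ ^ 2 := by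
  classical
  induction A using Finset.induction_on with
  | empty => simp
  | insert j A hj ih =>
    rw [integral_sum_insert A hj a (fun z => ‖z‖ ^ 2), Finset.sum_insert hj, ← ih]
    have : ∀ z w : ℂ, (‖z + w‖ ^ 2 + ‖z - w‖ ^ 2) / 2 = ‖w‖ ^ 2 + ‖z‖ ^ 2 := by
      intro z w
      have := parallelogram_law_with_norm ℝ z w
      nlinarith
    simp only [this]
    rw [integral_add (integrable_const _)
      (integrable_comp_sum_sign A a fun z => ‖z‖ ^ 2)]
    simp

/-- The constant 3 closes the induction: a new term `w` creates the cross term `6‖w‖²‖z‖²`, which is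
the cross term of `3(S + ‖w‖²)²`. -/
theorem integral_norm_pow_four_sum_sign_le (A : Finset ι) (a : ι → ℂ) :
    ∫ ε, ‖∑ i ∈ A, sign (ε i) • a i‖ ^ 4 ∂(signMeasure ι) ≤ 3 * (∑ i ∈ A, ‖a i‖ ^ 2) ^ 2 := by
  classical
  induction A using Finset.induction_on with
  | empty => simp
  | insert j A hj ih =>
    rw [integral_sum_insert A hj a (fun z => ‖z‖ ^ 4), Finset.sum_insert hj]
    have key : ∀ z w : ℂ, (‖z + w‖ ^ 4 + ‖z - w‖ ^ 4) / 2 ≤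
        ‖w‖ ^ 4 + (‖z‖ ^ 4 + 6 * ‖w‖ ^ 2 * ‖z‖ ^ 2) := by
      intro z w
      have h1 := norm_add_sq_real z w
      have h2 := norm_sub_sq_real z w
      have h3 : (inner ℝ z w) ^ 2 ≤ (‖z‖ * ‖w‖) ^ 2 :=
        sq_le_sq' (by linarith [neg_abs_le (inner ℝ z w), abs_real_inner_le_norm z w])
          (by linarith [le_abs_self (inner ℝ z w), abs_real_inner_le_norm z w])
      have h4 : ‖z + w‖ ^ 4 = (‖z + w‖ ^ 2) ^ 2 := by ring
      have h5 : ‖z - w‖ ^ 4 = (‖z - w‖ ^ 2) ^ 2 := by ring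
      rw [h4, h5, h1, h2]
      nlinarith
    have i2 : Integrable (fun ε => ‖∑ i ∈ A, sign (ε i) • a i‖ ^ 2) (signMeasure ι) :=
      integrable_comp_sum_sign A a fun z => ‖z‖ ^ 2
    have i4 : Integrable (fun ε => ‖∑ i ∈ A, sign (ε i) • a i‖ ^ 4) (signMeasure ι) :=
      integrable_comp_sum_sign A a fun z => ‖z‖ ^ 4
    have i0 : Integrable (fun _ => ‖a j‖ ^ 4) (signMeasure ι) := integrable_const _
    have i6 := i2.const_mul (6 * ‖a j‖ ^ 2)
    refine (integral_mono (integrable_comp_sum_sign A a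
      fun z => (‖z + a j‖ ^ 4 + ‖z - a j‖ ^ 4) / 2) (i0.add (i4.add i6))
      (fun ε => key _ _)).trans ?_
    rw [integral_add' i0 (i4.add i6), integral_add' i4 i6, integral_const_mul,
      integral_norm_sq_sum_sign]
    simp only [integral_const, probReal_univ, one_smul]
    nlinarith [sq_nonneg (‖a j‖ ^ 2)]

/-- Khintchine's inequality between the first and the second moment. -/
theorem sqrt_sum_norm_sq_le (A : Finset ι) (a : ι → ℂ) :
    √(∑ i ∈ A, ‖a i‖ ^ 2) ≤ 2 * ∫ ε, ‖∑ i ∈ A, sign (ε i) • a i‖ ∂(signMeasure ι) := by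
  set s := √(∑ i ∈ A, ‖a i‖ ^ 2) with hs
  have hs2 : s ^ 2 = ∑ i ∈ A, ‖a i‖ ^ 2 := Real.sq_sqrt (by positivity)
  rcases (Real.sqrt_nonneg (∑ i ∈ A, ‖a i‖ ^ 2)).eq_or_lt with h0 | h0
  · rw [hs, ← h0]
    positivity
  · rw [← hs] at h0
    have i1 : Integrable (fun ε => ‖∑ i ∈ A, sign (ε i) • a i‖) (signMeasure ι) :=
      integrable_comp_sum_sign A a fun z => ‖z‖
    have i2 : Integrable (fun ε => ‖∑ i ∈ A, sign (ε i) • a i‖ ^ 2) (signMeasure ι) :=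
      integrable_comp_sum_sign A a fun z => ‖z‖ ^ 2
    have i4 : Integrable (fun ε => ‖∑ i ∈ A, sign (ε i) • a i‖ ^ 4) (signMeasure ι) :=
      integrable_comp_sum_sign A a fun z => ‖z‖ ^ 4
    -- A lower bound for `x` by a combination of `x²` and `x⁴`. Scaled to `s = 1` it says `5y³ - 45y
    -- + 54 ≥ 0`, whose minimum on `y ≥ 0`, at `√3 ≈ 17/10`, is positive. Integrating with the two
    -- moments gives `30 s ≤ 54 E`, where `E` is the first moment, hence `s ≤ 2E`.
    have key : ∀ x : ℝ, 0 ≤ x → 45 * s ^ 2 * x ^ 2 - 5 * x ^ 4 ≤ 54 * s ^ 3 * x := by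
      intro x hx
      obtain ⟨y, rfl⟩ : ∃ y, x = s * y := ⟨x / s, by field_simp⟩
      have hy : 0 ≤ y := by
        by_contra h
        push Not at h
        nlinarith
      have h1 : 0 ≤ y * (5 * y ^ 3 - 45 * y + 54) :=
        mul_nonneg hy (by nlinarith [sq_nonneg (y - 17 / 10), mul_nonneg hy (sq_nonneg (y - 17 / 10))])
      have h2 : 0 ≤ s ^ 4 * (y * (5 * y ^ 3 - 45 * y + 54)) := by positivity
      nlinarith
    have h := integral_mono ((i2.const_mul (45 * s ^ 2)).sub (i4.const_mul 5))
      (i1.const_mul (54 * s ^ 3)) (fun ε => key _ (norm_nonneg _))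
    simp only [Pi.sub_apply] at h
    rw [integral_sub (i2.const_mul (45 * s ^ 2)) (i4.const_mul 5), integral_const_mul,
      integral_const_mul, integral_const_mul, integral_norm_sq_sum_sign, ← hs2] at h
    have h4 := integral_norm_pow_four_sum_sign_le A a
    rw [← hs2] at h4
    have h5 : 0 ≤ s ^ 3 * (54 * (∫ ε, ‖∑ i ∈ A, sign (ε i) • a i‖ ∂(signMeasure ι)) - 30 * s) := by
      nlinarith
    have h6 := nonneg_of_mul_nonneg_right h5 (by positivity)
    linarith

/-- Independent signs may be inserted along a map of the index set. -/
theorem lintegral_flip_comp (π : ι → κ) {N : (ι → Bool) → ℝ≥0∞} (hN : Measurable N) :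
    ∫⁻ ε, N ε ∂(signMeasure ι) =
      ∫⁻ ε, ∫⁻ η, N (flip (η ∘ π) ε) ∂(signMeasure κ) ∂(signMeasure ι) := by
  -- For fixed `η` the flip by `η ∘ π` preserves the law of `ε`, so after the swap the inner
  -- integral no longer depends on `η`.
  rw [lintegral_lintegral_swap]
  · have : ∀ η : κ → Bool, ∫⁻ ε, N (flip (η ∘ π) ε) ∂(signMeasure ι) =
        ∫⁻ ε, N ε ∂(signMeasure ι) := fun η => (measurePreserving_flip (η ∘ π)).lintegral_comp hN
    simp [this]
  · refine (hN.comp (measurable_pi_lambda _ fun i => ?_)).aemeasurable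
    have hb : Measurable fun b : Bool × Bool => b.1 == b.2 := Measurable.of_discrete
    have hc : Measurable fun z : (ι → Bool) × (κ → Bool) => (z.1 i, z.2 (π i)) := by fun_prop
    exact hb.comp hc

end Signs

/-! ### Trigonometric polynomials, measurability and truncation. -/

section TrigonometricPolynomials

variable {G : Type*} [CommGroup G] [TopologicalSpace G] [IsTopologicalGroup G] [CompactSpace G]
  [MeasurableSpace G] [BorelSpace G]

theorem eLpNorm_top_toLp (F : C(G, ℂ)) :
    eLpNorm (ContinuousMap.toLp 2 (haar G) ℂ F) ∞ (haar G) = ‖F‖ₑ := by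
  rw [eLpNorm_congr_ae (ContinuousMap.coeFn_toLp (haar G) F), eLpNorm_exponent_top]
  refine le_antisymm (essSup_le_of_ae_le _ (Filter.Eventually.of_forall fun x => ?_)) ?_
  · simp only [← ofReal_norm]
    exact ENNReal.ofReal_le_ofReal (F.norm_coe_le_norm x)
  · set c := eLpNormEssSup F (haar G) with hc
    by_cases htop : c = ∞
    · simp [htop]
    -- An open null set is empty, since Haar measure charges nonempty open sets.
    have h0 : {x | c < ‖F x‖ₑ} = ∅ := by
      refine (isOpen_lt continuous_const F.continuous.enorm).eq_empty_of_measure_zero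
        (μ := haar G) ?_
      have := enorm_ae_le_eLpNormEssSup F (haar G)
      rw [ae_iff] at this
      simpa using this
    rw [← ofReal_norm, ← ENNReal.ofReal_toReal htop]
    refine ENNReal.ofReal_le_ofReal ((ContinuousMap.norm_le _ ENNReal.toReal_nonneg).2 fun x => ?_)
    have hx : ‖F x‖ₑ ≤ c := by
      by_contra h
      exact (Set.mem_empty_iff_false x).1 (h0 ▸ not_le.1 h)
    rw [← toReal_enorm]
    exact ENNReal.toReal_mono htop hx

theorem inner_charL2_toLp (f : C(G, ℂ)) (γ : PontryaginDual G) :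
    inner ℂ (charL2 γ) (ContinuousMap.toLp 2 (haar G) ℂ f) = fourierCoeff f γ := by
  unfold charL2
  rw [ContinuousMap.inner_toLp]
  rfl

theorem toLp_sum_charFun (S : Finset (PontryaginDual G)) (c : PontryaginDual G → ℂ) :
    ContinuousMap.toLp 2 (haar G) ℂ (∑ γ ∈ S, c γ • charFun γ) = ∑ γ ∈ S, c γ • charL2 γ := by
  simp [map_sum, charL2]

open scoped Classical in
theorem fourierCoeff_sum_charFun (S : Finset (PontryaginDual G)) (c : PontryaginDual G → ℂ)
    (δ : PontryaginDual G) :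
    fourierCoeff (∑ γ ∈ S, c γ • charFun γ) δ = if δ ∈ S then c δ else 0 := by
  rw [← inner_charL2_toLp, toLp_sum_charFun, inner_sum]
  simp [inner_smul_right, orthonormal_iff_ite.1 orthonormal_charL2]

theorem coeffNorm_sum_charFun {p : ℝ} (hp : 0 < p) (S : Finset (PontryaginDual G))
    (c : PontryaginDual G → ℂ) :
    coeffNorm p (∑ γ ∈ S, c γ • charFun γ) = (∑ γ ∈ S, ‖c γ‖ₑ ^ p) ^ (1 / p) := by
  unfold coeffNorm
  rw [tsum_eq_sum (s := S)]
  · congr 1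
    exact Finset.sum_congr rfl fun γ hγ => by rw [fourierCoeff_sum_charFun, if_pos hγ]
  · intro γ hγ
    rw [fourierCoeff_sum_charFun, if_neg hγ]
    simp [hp]

theorem randomNorm_sum_charFun (S : Finset (PontryaginDual G)) (c : PontryaginDual G → ℂ) :
    randomNorm (∑ γ ∈ S, c γ • charFun γ) =
      ∫⁻ ε, ‖∑ γ ∈ S, (sign (ε γ) * c γ) • charFun γ‖ₑ ∂(signMeasure (PontryaginDual G)) := by
  unfold randomNorm
  refine lintegral_congr fun ε => ?_
  rw [← eLpNorm_top_toLp, toLp_sum_charFun S fun γ => sign (ε γ) * c γ]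
  unfold randomSeries
  rw [tsum_eq_sum (s := S)]
  · have : ∀ γ ∈ S, (sign (ε γ) * fourierCoeff (∑ γ ∈ S, c γ • charFun γ) γ) • charL2 γ =
        (sign (ε γ) * c γ) • charL2 γ := fun γ hγ => by rw [fourierCoeff_sum_charFun, if_pos hγ]
    rw [Finset.sum_congr rfl this]
  · intro γ hγ
    rw [fourierCoeff_sum_charFun, if_neg hγ]
    simp

/-- A bound on the essential supremum survives `L²` limits, because these are limits in measure. -/
theorem lowerSemicontinuous_eLpNorm_top {α : Type*} [MeasurableSpace α] (μ : Measure α) :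
    LowerSemicontinuous fun g : Lp ℂ 2 μ => eLpNorm g ∞ μ := by
  rw [lowerSemicontinuous_iff_isClosed_preimage]
  intro c
  refine IsSeqClosed.isClosed fun g g₀ hg hlim => ?_
  exact eLpNorm_le_of_tendstoInMeasure (Filter.Eventually.of_forall hg)
    (tendstoInMeasure_of_tendsto_Lp hlim) fun n => Lp.aestronglyMeasurable _

theorem measurable_tsum_sign {ι E : Type*} [NormedAddCommGroup E] [NormedSpace ℂ E]
    [MeasurableSpace E] [BorelSpace E] (v : ι → E)
    (hv : ∀ ε : ι → Bool, Summable fun i => sign (ε i) • v i) :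
    Measurable fun ε : ι → Bool => ∑' i, sign (ε i) • v i := by
  -- Summability leaves only countably many nonzero terms, so the finite partial sums converge along
  -- a countably generated filter and the limit is measurable.
  set s : Set ι := Function.support v with hs
  have hcount : Countable s := by
    have h := (hv fun _ => true).countable_support
    simp only [sign, if_true, one_smul] at h
    exact h.to_subtype
  have hsum : ∀ ε : ι → Bool,
      HasSum (fun i : s => sign (ε i) • v i) (∑' i, sign (ε i) • v i) := by
    intro ε
    refine (hasSum_subtype_iff_of_support_subset (f := fun i => sign (ε i) • v i) ?_).2
      (hv ε).hasSum
    intro i hi h0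
    simp [h0] at hi
  refine measurable_of_tendsto_metrizable' (f := fun (A : Finset s) (ε : ι → Bool) =>
    ∑ i ∈ A, sign (ε i) • v i) Filter.atTop (fun A => ?_) (tendsto_pi_nhds.2 hsum)
  refine (stronglyMeasurable_of_dependsOn (A := A.map (Function.Embedding.subtype _)) ?_).measurable
  intro ε ε' h
  refine Finset.sum_congr rfl fun i hi => ?_
  rw [h i (by simpa using hi)]

theorem measurable_eLpNorm_randomSeries (f : C(G, ℂ)) :
    Measurable fun ε => eLpNorm (randomSeries f ε) ∞ (haar G) := by
  borelize ↥(Lp ℂ 2 (haar G))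
  have h := measurable_tsum_sign (fun γ => fourierCoeff f γ • charL2 γ) fun ε => by
    simpa only [smul_smul] using summable_randomSeries f ε
  simp only [smul_smul] at h
  exact (lowerSemicontinuous_eLpNorm_top (haar G)).measurable.comp h

/-- Truncating a random Fourier series to finitely many characters decreases its mean norm. -/
theorem lintegral_sum_charFun_le_randomNorm (f : C(G, ℂ)) (A : Finset (PontryaginDual G)) :
    ∫⁻ ε, ‖∑ γ ∈ A, (sign (ε γ) * fourierCoeff f γ) • charFun γ‖ₑ
      ∂(signMeasure (PontryaginDual G)) ≤ randomNorm f := by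
  classical
  -- Flipping by `η` reverses the signs off `A`; adding the two series doubles the part on `A` and
  -- cancels the rest.
  set η : PontryaginDual G → Bool := fun γ => decide (γ ∈ A)
  have hm := measurable_eLpNorm_randomSeries f
  have hflip := (measurePreserving_flip η).lintegral_comp hm
  have key : ∀ ε, 2 * ‖∑ γ ∈ A, (sign (ε γ) * fourierCoeff f γ) • charFun γ‖ₑ ≤
      eLpNorm (randomSeries f ε) ∞ (haar G) + eLpNorm (randomSeries f (flip η ε)) ∞ (haar G) := by
    intro ε
    have h1 : randomSeries f ε + randomSeries f (flip η ε) =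
        (2 : ℂ) • ContinuousMap.toLp 2 (haar G) ℂ
          (∑ γ ∈ A, (sign (ε γ) * fourierCoeff f γ) • charFun γ) := by
      rw [toLp_sum_charFun A fun γ => sign (ε γ) * fourierCoeff f γ, Finset.smul_sum]
      unfold randomSeries
      rw [← (summable_randomSeries f ε).tsum_add (summable_randomSeries f (flip η ε)),
        tsum_eq_sum (s := A)]
      · refine Finset.sum_congr rfl fun γ hγ => ?_
        rw [sign_flip]
        simp only [η, hγ, sign, decide_true, if_true, mul_one, two_smul]
      · intro γ hγ
        rw [sign_flip]
        simp [η, hγ, sign]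
    have h2 : eLpNorm (randomSeries f ε + randomSeries f (flip η ε) : Lp ℂ 2 (haar G)) ∞ (haar G) =
        2 * ‖∑ γ ∈ A, (sign (ε γ) * fourierCoeff f γ) • charFun γ‖ₑ := by
      rw [h1, eLpNorm_congr_ae (Lp.coeFn_smul _ _), eLpNorm_const_smul, eLpNorm_top_toLp]
      congr 1
      rw [← ofReal_norm]
      simp
    rw [← h2, eLpNorm_congr_ae (Lp.coeFn_add _ _)]
    exact eLpNorm_add_le (Lp.aestronglyMeasurable _) (Lp.aestronglyMeasurable _) le_top
  have h := lintegral_mono (μ := signMeasure (PontryaginDual G)) key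
  rw [lintegral_const_mul' _ _ (by simp), lintegral_add_left hm, hflip, ← two_mul] at h
  exact (ENNReal.mul_le_mul_iff_right (by simp) (by simp)).1 h

end TrigonometricPolynomials

/-! ### A Blei-type inequality for mixed norms. -/

section MixedNorms

variable {X J : Type*} [Fintype J] [DecidableEq J] {Y : J → Type*} [∀ j, DecidableEq (Y j)]

open Finset

/-- The normalized form of `sum_rpow_le_of_mixed_norms`. -/
theorem sum_rpow_le_one_of_mixed_norms (A : Finset X) (π : ∀ j, X → Y j)
    (hπ : Function.Injective fun x j => π j x) (u : X → ℝ) (hu : ∀ x, 0 ≤ u x) (p : J → ℝ)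
    (hp : ∀ j, 1 ≤ p j) (hp2 : ∀ j, p j < 2) {q R : ℝ} (hRpos : 0 < R)
    (hR : R = ∑ j, p j / (2 - p j)) (hq : q = 2 * R / (R + 1))
    (h : ∀ j, ∑ y ∈ A.image (π j), √(∑ x ∈ A with π j x = y, u x ^ 2) ^ p j ≤ 1) :
    ∑ x ∈ A, u x ^ q ≤ 1 := by
  set T : ∀ j, Y j → ℝ := fun j y => √(∑ x ∈ A with π j x = y, u x ^ 2) with hT
  have hT0 : ∀ j y, 0 ≤ T j y := fun j y => Real.sqrt_nonneg _
  have hTsq : ∀ j y, T j y ^ 2 = ∑ x ∈ A with π j x = y, u x ^ 2 := fun j y =>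
    Real.sq_sqrt (sum_nonneg fun x _ => sq_nonneg _)
  have hle : ∀ j, ∀ x ∈ A, u x ≤ T j (π j x) := by
    intro j x hx
    refine Real.le_sqrt_of_sq_le ?_
    exact single_le_sum (f := fun x => u x ^ 2) (fun i _ => sq_nonneg _) (by simp [hx])
  have hq0 : 0 < q := by rw [hq]; positivity
  have hd : ∀ j, 0 < 2 - p j := fun j => by linarith [hp2 j]
  have hp0 : ∀ j, 0 < p j := fun j => by linarith [hp j]
  -- AM-GM weights. They satisfy `(2 - p j) * w j = p j / (R + 1)`, so the powers of `T j` cancel in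
  -- the geometric mean. With the weight `1 / (R + 1)` of the product term they sum to 1, and the
  -- exponent left on `u x` is `2R/(R+1) = q`.
  set w : J → ℝ := fun j => p j / (2 - p j) / (R + 1) with hw
  have hw0 : ∀ j, 0 ≤ w j := fun j => by have := hd j; have := hp0 j; positivity
  have hwsum : ∑ j, w j = R / (R + 1) := by rw [← sum_div, ← hR]
  have point : ∀ x ∈ A, u x ^ q ≤ ∑ j, w j * (u x ^ 2 * T j (π j x) ^ (p j - 2)) +
      1 / (R + 1) * ∏ j, T j (π j x) ^ p j := by
    intro x hx
    -- Cancelling the negative powers of `T j` needs `T j > 0`, which `u x > 0` guarantees.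
    rcases (hu x).eq_or_lt with h0 | h0
    · rw [← h0, Real.zero_rpow hq0.ne']
      have : 0 ≤ ∏ j, T j (π j x) ^ p j :=
        prod_nonneg fun j _ => Real.rpow_nonneg (hT0 _ _) _
      simp only [ne_eq, OfNat.ofNat_ne_zero, not_false_eq_true, zero_pow, zero_mul, mul_zero,
        sum_const_zero, zero_add]
      positivity
    · have hTpos : ∀ j, 0 < T j (π j x) := fun j => h0.trans_le (hle j x hx)
      have ham := Real.geom_mean_le_arith_mean_weighted (univ : Finset (Option J))
        (fun o => o.elim (1 / (R + 1)) w)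
        (fun o => o.elim (∏ j, T j (π j x) ^ p j)
          fun j => u x ^ 2 * T j (π j x) ^ (p j - 2))
        (by
          rintro (_ | j) _
          · exact (by positivity : (0 : ℝ) ≤ 1 / (R + 1))
          · exact hw0 j)
        (by
          rw [Fintype.sum_option]
          simp only [Option.elim]
          rw [hwsum, ← add_div, add_comm, div_self (by positivity)])
        (by
          rintro (_ | j) _
          · exact prod_nonneg fun j _ => Real.rpow_nonneg (hT0 _ _) _
          · exact mul_nonneg (sq_nonneg _) (Real.rpow_nonneg (hT0 _ _) _))
      rw [Fintype.sum_option, Fintype.prod_option] at ham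
      simp only [Option.elim] at ham
      rw [add_comm]
      refine le_trans (le_of_eq ?_) ham
      rw [← Real.finsetProd_rpow _ _ fun j _ => Real.rpow_nonneg (hT0 _ _) _, ← prod_mul_distrib]
      have hfac : ∀ j, (T j (π j x) ^ p j) ^ (1 / (R + 1)) *
          (u x ^ 2 * T j (π j x) ^ (p j - 2)) ^ w j = u x ^ (2 * w j) := by
        intro j
        rw [Real.mul_rpow (sq_nonneg _) (Real.rpow_nonneg (hT0 _ _) _), ← Real.rpow_mul (hT0 _ _),
          ← Real.rpow_mul (hT0 _ _), ← Real.rpow_natCast (u x) 2, ← Real.rpow_mul (hu x),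
          mul_left_comm, ← Real.rpow_add (hTpos j)]
        have : p j * (1 / (R + 1)) + (p j - 2) * w j = 0 := by
          have := (hd j).ne'
          simp only [hw]
          field_simp
          ring
        rw [this]
        simp
      simp only [hfac]
      rw [← Real.rpow_sum_of_pos h0, ← mul_sum, hwsum, hq]
      congr 1
      ring
  refine (sum_le_sum point).trans ?_
  rw [sum_add_distrib, sum_comm, ← mul_sum]
  have h1 : ∀ j, ∑ x ∈ A, w j * (u x ^ 2 * T j (π j x) ^ (p j - 2)) ≤ w j := by
    intro j
    rw [← mul_sum]
    refine mul_le_of_le_one_right (hw0 j) (le_trans (le_of_eq ?_) (h j))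
    rw [← sum_fiberwise_of_maps_to (fun x hx => mem_image_of_mem (π j) hx)]
    refine sum_congr rfl fun y _ => ?_
    change _ = T j y ^ p j
    have : ∀ x ∈ A.filter (fun x => π j x = y), u x ^ 2 * T j (π j x) ^ (p j - 2) =
        u x ^ 2 * T j y ^ (p j - 2) := fun x hx => by rw [(mem_filter.1 hx).2]
    rw [sum_congr rfl this, ← sum_mul, ← hTsq]
    rcases (hT0 j y).eq_or_lt with h0 | h0
    · rw [← h0, Real.zero_rpow (hp0 j).ne']; simp
    · rw [← Real.rpow_natCast, ← Real.rpow_add h0]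
      congr 1
      push_cast
      ring
  -- By injectivity `x` may be replaced by its tuple of coordinates; the sum over the full box of
  -- tuples then factors.
  have h2 : ∑ x ∈ A, ∏ j, T j (π j x) ^ p j ≤ 1 := by
    calc ∑ x ∈ A, ∏ j, T j (π j x) ^ p j
        = ∑ z ∈ A.image (fun x j => π j x), ∏ j, T j (z j) ^ p j :=
          (sum_image (f := fun z : ∀ j, Y j => ∏ j, T j (z j) ^ p j) hπ.injOn).symm
      _ ≤ ∑ z ∈ Fintype.piFinset fun j => A.image (π j), ∏ j, T j (z j) ^ p j := by
          refine sum_le_sum_of_subset_of_nonneg ?_ fun z _ _ =>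
            prod_nonneg fun j _ => Real.rpow_nonneg (hT0 _ _) _
          intro z hz
          obtain ⟨x, hx, rfl⟩ := mem_image.1 hz
          exact Fintype.mem_piFinset.2 fun j => mem_image_of_mem _ hx
      _ = ∏ j, ∑ y ∈ A.image (π j), T j y ^ p j :=
          (prod_univ_sum (fun j => A.image (π j)) fun j y => T j y ^ p j).symm
      _ ≤ 1 := prod_le_one (fun j _ => sum_nonneg fun y _ => Real.rpow_nonneg (hT0 _ _) _)
          fun j _ => h j
  calc _ ≤ ∑ j, w j + 1 / (R + 1) * 1 := by
        gcongr with j _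
        exact h1 j
    _ = 1 := by rw [hwsum]; field_simp

/-- An inequality of Blei type: `ℓ^(p j)`-bounds, one for each coordinate `j`, on the `ℓ²` norms
of the fibres over the `j`-th coordinate give an `ℓ^q` bound. -/
theorem sum_rpow_le_of_mixed_norms (A : Finset X) (π : ∀ j, X → Y j)
    (hπ : Function.Injective fun x j => π j x) (u : X → ℝ) (hu : ∀ x, 0 ≤ u x) (p : J → ℝ)
    (hp : ∀ j, 1 ≤ p j) (hp2 : ∀ j, p j < 2) {q R : ℝ} (hRpos : 0 < R)
    (hR : R = ∑ j, p j / (2 - p j)) (hq : q = 2 * R / (R + 1)) {K : ℝ} (hK : 0 < K)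
    (h : ∀ j, ∑ y ∈ A.image (π j), √(∑ x ∈ A with π j x = y, u x ^ 2) ^ p j ≤ K ^ p j) :
    ∑ x ∈ A, u x ^ q ≤ K ^ q := by
  have h1 := sum_rpow_le_one_of_mixed_norms A π hπ (fun x => u x / K)
    (fun x => div_nonneg (hu x) hK.le) p hp hp2 hRpos hR hq (fun j => by
      have : ∀ y, √(∑ x ∈ A with π j x = y, (u x / K) ^ 2) =
          √(∑ x ∈ A with π j x = y, u x ^ 2) / K := by
        intro y
        simp only [div_pow]
        rw [← sum_div, Real.sqrt_div' _ (sq_nonneg K), Real.sqrt_sq hK.le]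
      simp only [this, Real.div_rpow (Real.sqrt_nonneg _) hK.le]
      rw [← sum_div]
      exact div_le_one_of_le₀ (h j) (Real.rpow_nonneg hK.le _))
  simp only [Real.div_rpow (hu _) hK.le] at h1
  rwa [← sum_div, div_le_one (Real.rpow_pos_of_pos hK _)] at h1

end MixedNorms

/-! ### Restriction along a homomorphism and the mixed-norm estimate. -/

/-- Minkowski's integral inequality for finitely many functions. -/
theorem rpow_sum_integral_le {Ω Y : Type*} [MeasurableSpace Ω] {μ : Measure Ω} (S : Finset Y)
    {p : ℝ} (hp : 1 ≤ p) (F : Y → Ω → ℝ) (hF : ∀ y ∈ S, Integrable (F y) μ) :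
    (∑ y ∈ S, ‖∫ ω, F y ω ∂μ‖ ^ p) ^ (1 / p) ≤ ∫ ω, (∑ y ∈ S, ‖F y ω‖ ^ p) ^ (1 / p) ∂μ := by
  have hpt : (ENNReal.ofReal p).toReal = p := ENNReal.toReal_ofReal (by linarith)
  have hp0 : 0 < (ENNReal.ofReal p).toReal := by rw [hpt]; linarith
  have : Fact (1 ≤ ENNReal.ofReal p) := ⟨by simpa using hp⟩
  -- The norm inequality for Bochner integrals, with values in the finite-dimensional `ℓ^p` space on
  -- `S`.
  have h := norm_integral_le_integral_norm (μ := μ)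
    fun ω => WithLp.toLp (ENNReal.ofReal p) fun y : S => F y ω
  simp only [PiLp.norm_eq_sum hp0, hpt] at h
  have he : ∀ y : S, (∫ ω, WithLp.toLp (ENNReal.ofReal p) (fun y : S => F y ω) ∂μ).ofLp y =
      ∫ ω, F y ω ∂μ := eval_integral_piLp fun y => hF y.1 y.2
  simp only [he] at h
  rw [Finset.sum_coe_sort S fun y => ‖∫ ω, F y ω ∂μ‖ ^ p] at h
  refine h.trans (le_of_eq (integral_congr_ae (Filter.Eventually.of_forall fun ω => ?_)))
  exact congrArg (· ^ (1 / p)) (Finset.sum_coe_sort S fun y => ‖F y ω‖ ^ p)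

theorem enorm_sum_charFun_map_le {G H : Type*} [CommGroup G] [TopologicalSpace G]
    [CompactSpace G] [CommGroup H] [TopologicalSpace H] [CompactSpace H] (φ : H →ₜ* G)
    (A : Finset (PontryaginDual G)) (c : PontryaginDual G → ℂ) :
    ‖∑ χ ∈ A, c χ • charFun (PontryaginDual.map φ χ)‖ₑ ≤ ‖∑ χ ∈ A, c χ • charFun χ‖ₑ := by
  rw [← ofReal_norm, ← ofReal_norm]
  refine ENNReal.ofReal_le_ofReal ((ContinuousMap.norm_le _ (norm_nonneg _)).2 fun t => ?_)
  refine le_trans (le_of_eq ?_) (ContinuousMap.norm_coe_le_norm _ (φ t))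
  simp [ContinuousMap.sum_apply, charFun]

section Restriction

variable {G H : Type*} [CommGroup G] [TopologicalSpace G] [IsTopologicalGroup G] [CompactSpace G]
  [MeasurableSpace G] [BorelSpace G]
  [CommGroup H] [TopologicalSpace H] [IsTopologicalGroup H] [CompactSpace H]
  [MeasurableSpace H] [BorelSpace H]

open scoped Classical in
/-- Restriction of a function on `G` along `φ : H → G` to a group `H` on which the Rider
inequality holds bounds the mixed norm of its Fourier transform over the fibres of the dual
homomorphism of `φ`. -/
theorem ofReal_mixed_norm_le (φ : H →ₜ* G) {p κ : ℝ} (hp : 1 ≤ p)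
    {Λ : Set (PontryaginDual H)}
    (hΛ : ∀ h : C(H, ℂ), (∀ γ, γ ∉ Λ → fourierCoeff h γ = 0) →
      coeffNorm p h ≤ ENNReal.ofReal κ * randomNorm h)
    (f : C(G, ℂ)) (A : Finset (PontryaginDual G)) (hA : ∀ χ ∈ A, PontryaginDual.map φ χ ∈ Λ) :
    ENNReal.ofReal ((∑ γ ∈ A.image (PontryaginDual.map φ),
      √(∑ χ ∈ A with PontryaginDual.map φ χ = γ, ‖fourierCoeff f χ‖ ^ 2) ^ p) ^ (1 / p)) ≤
      2 * (ENNReal.ofReal κ * randomNorm f) := by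
  set π : PontryaginDual G → PontryaginDual H := ⇑(PontryaginDual.map φ) with hπ
  set a := fourierCoeff f with ha
  set S := A.image π with hS
  set g : (PontryaginDual G → Bool) → PontryaginDual H → ℂ :=
    fun ε γ => ∑ χ ∈ A with π χ = γ, sign (ε χ) • a χ with hg
  have hp0 : 0 < p := by linarith
  have hgdep : ∀ γ, DependsOn (fun ε => g ε γ) (A : Set (PontryaginDual G)) := fun γ =>
    (dependsOn_sum_sign _ a).mono fun χ hχ => (Finset.mem_filter.1 hχ).1
  have hgi : ∀ γ, Integrable (fun ε => ‖g ε γ‖) (signMeasure (PontryaginDual G)) := fun γ =>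
    integrable_of_dependsOn (dependsOn_comp norm (hgdep γ))
  have hNi : Integrable (fun ε => (∑ γ ∈ S, ‖g ε γ‖ ^ p) ^ (1 / p))
      (signMeasure (PontryaginDual G)) := by
    refine integrable_of_dependsOn (A := A) fun ε ε' h => ?_
    simp only [fun γ => hgdep γ h]
  -- Khintchine on each fibre, with its constant 2, then Minkowski to take the expectation outside
  -- the `ℓ^p` norm.
  have hreal : (∑ γ ∈ S, √(∑ χ ∈ A with π χ = γ, ‖a χ‖ ^ 2) ^ p) ^ (1 / p) ≤
      2 * ∫ ε, (∑ γ ∈ S, ‖g ε γ‖ ^ p) ^ (1 / p) ∂(signMeasure (PontryaginDual G)) := by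
    have hmink := rpow_sum_integral_le (μ := signMeasure (PontryaginDual G)) S hp
      (fun γ ε => ‖g ε γ‖) fun γ _ => hgi γ
    simp only [norm_norm] at hmink
    refine le_trans ?_ (mul_le_mul_of_nonneg_left hmink zero_le_two)
    have h2 : (2 : ℝ) = (2 ^ p) ^ (1 / p) := by
      rw [← Real.rpow_mul zero_le_two, mul_one_div_cancel hp0.ne', Real.rpow_one]
    conv_rhs => rw [h2]
    rw [← Real.mul_rpow (by positivity) (by positivity), Finset.mul_sum]
    refine Real.rpow_le_rpow (by positivity) (Finset.sum_le_sum fun γ _ => ?_) (by positivity)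
    rw [← Real.mul_rpow zero_le_two (norm_nonneg _)]
    refine Real.rpow_le_rpow (Real.sqrt_nonneg _) ?_ hp0.le
    rw [Real.norm_of_nonneg (integral_nonneg fun _ => norm_nonneg _)]
    exact sqrt_sum_norm_sq_le _ a
  have hcoeff : ∀ ε, ENNReal.ofReal ((∑ γ ∈ S, ‖g ε γ‖ ^ p) ^ (1 / p)) =
      coeffNorm p (∑ γ ∈ S, g ε γ • charFun γ) := by
    intro ε
    rw [coeffNorm_sum_charFun hp0, ← ENNReal.ofReal_rpow_of_nonneg (by positivity) (by positivity),
      ENNReal.ofReal_sum_of_nonneg fun γ _ => by positivity]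
    congr 1
    refine Finset.sum_congr rfl fun γ _ => ?_
    rw [← ENNReal.ofReal_rpow_of_nonneg (norm_nonneg _) hp0.le, ofReal_norm]
  set N : (PontryaginDual G → Bool) → ℝ≥0∞ :=
    fun ε => ‖∑ χ ∈ A, (sign (ε χ) * a χ) • charFun (π χ)‖ₑ with hN
  have hNm : Measurable N := by
    refine (stronglyMeasurable_of_dependsOn (A := A) fun ε ε' h => ?_).measurable
    simp only [hN]
    congr 1
    exact Finset.sum_congr rfl fun χ hχ => by rw [h χ hχ]
  -- A sign `η γ` on a merged coefficient multiplies all signs in the fibre over `γ`, which is the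
  -- flip by `η ∘ π`.
  have hrand : ∀ ε, randomNorm (∑ γ ∈ S, g ε γ • charFun γ) =
      ∫⁻ η, N (flip (η ∘ π) ε) ∂(signMeasure (PontryaginDual H)) := by
    intro ε
    rw [randomNorm_sum_charFun]
    refine lintegral_congr fun η => ?_
    simp only [hN]
    congr 1
    rw [← Finset.sum_fiberwise_of_maps_to fun χ hχ => Finset.mem_image_of_mem π hχ]
    refine Finset.sum_congr rfl fun γ _ => ?_
    rw [hg, Finset.mul_sum, Finset.sum_smul]
    refine Finset.sum_congr rfl fun χ hχ => ?_
    rw [(Finset.mem_filter.1 hχ).2, sign_flip, Function.comp_apply, (Finset.mem_filter.1 hχ).2,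
      smul_eq_mul]
    congr 1
    ring
  calc ENNReal.ofReal ((∑ γ ∈ S, √(∑ χ ∈ A with π χ = γ, ‖a χ‖ ^ 2) ^ p) ^ (1 / p))
      ≤ ENNReal.ofReal
          (2 * ∫ ε, (∑ γ ∈ S, ‖g ε γ‖ ^ p) ^ (1 / p) ∂(signMeasure (PontryaginDual G))) :=
        ENNReal.ofReal_le_ofReal hreal
    _ = 2 * ∫⁻ ε, coeffNorm p (∑ γ ∈ S, g ε γ • charFun γ) ∂(signMeasure (PontryaginDual G)) := by
        rw [ENNReal.ofReal_mul zero_le_two, ENNReal.ofReal_ofNat,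
          ofReal_integral_eq_lintegral_ofReal hNi
            (Filter.Eventually.of_forall fun ε => by positivity)]
        simp only [hcoeff]
    _ ≤ 2 * ∫⁻ ε, ENNReal.ofReal κ * ∫⁻ η, N (flip (η ∘ π) ε) ∂(signMeasure (PontryaginDual H))
          ∂(signMeasure (PontryaginDual G)) := by
        gcongr with ε
        rw [← hrand]
        refine hΛ _ fun γ hγ => ?_
        rw [fourierCoeff_sum_charFun, if_neg]
        intro h
        obtain ⟨χ, hχ, rfl⟩ := Finset.mem_image.1 h
        exact hγ (hA χ hχ)
    _ = 2 * (ENNReal.ofReal κ * ∫⁻ ε, N ε ∂(signMeasure (PontryaginDual G))) := by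
        rw [lintegral_const_mul' _ _ ENNReal.ofReal_ne_top, ← lintegral_flip_comp π hNm]
    _ ≤ 2 * (ENNReal.ofReal κ * randomNorm f) := by
        gcongr
        refine le_trans (lintegral_mono fun ε => ?_) (lintegral_sum_charFun_le_randomNorm f A)
        exact enorm_sum_charFun_map_le φ A fun χ => sign (ε χ) * a χ

end Restriction

/-! ### Passage to infinite spectra and the product theorem. -/

theorem coeffNorm_le_ofReal {G : Type*} [CommGroup G] [TopologicalSpace G] [IsTopologicalGroup G]
    [CompactSpace G] [MeasurableSpace G] [BorelSpace G] (f : C(G, ℂ)) {q K : ℝ} (hq : 0 < q)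
    (hK : 0 ≤ K) (h : ∀ A : Finset (PontryaginDual G), (∀ χ ∈ A, fourierCoeff f χ ≠ 0) →
      ∑ χ ∈ A, ‖fourierCoeff f χ‖ ^ q ≤ K ^ q) :
    coeffNorm q f ≤ ENNReal.ofReal K := by
  classical
  have hsum : ∑' χ, ‖fourierCoeff f χ‖ₑ ^ q ≤ ENNReal.ofReal K ^ q := by
    rw [ENNReal.tsum_eq_iSup_sum]
    refine iSup_le fun A => ?_
    -- Discarding zero coefficients leaves only characters that the support condition places in the
    -- spectral set.
    rw [← Finset.sum_filter_of_ne (p := fun χ => fourierCoeff f χ ≠ 0) (fun χ _ h0 hc => h0 (by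
      simp [hc, hq]))]
    have hterm : ∀ χ, ‖fourierCoeff f χ‖ₑ ^ q = ENNReal.ofReal (‖fourierCoeff f χ‖ ^ q) :=
      fun χ => by rw [← ENNReal.ofReal_rpow_of_nonneg (norm_nonneg _) hq.le, ofReal_norm]
    simp only [hterm]
    rw [← ENNReal.ofReal_sum_of_nonneg fun _ _ => by positivity,
      ENNReal.ofReal_rpow_of_nonneg hK hq.le]
    exact ENNReal.ofReal_le_ofReal (h _ fun χ hχ => (Finset.mem_filter.1 hχ).2)
  refine (ENNReal.rpow_le_rpow hsum (by positivity)).trans (le_of_eq ?_)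
  rw [← ENNReal.rpow_mul, mul_one_div_cancel hq.ne', ENNReal.rpow_one]

/-- The inclusion of the `j`-th factor in a product of topological groups. -/
def inclusion {ι : Type*} [DecidableEq ι] (G : ι → Type*) [∀ j, CommGroup (G j)]
    [∀ j, TopologicalSpace (G j)] (j : ι) : G j →ₜ* ∀ j, G j where
  toMonoidHom := MonoidHom.mulSingle G j
  continuous_toFun := continuous_mulSingle j

/-- Restriction to a factor is the coordinate projection on characters; hence the restrictions to
all factors jointly separate characters. -/
theorem map_inclusion {ι : Type*} [Fintype ι] [DecidableEq ι] (G : ι → Type*)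
    [∀ j, CommGroup (G j)] [∀ j, TopologicalSpace (G j)] (χ : PontryaginDual (∀ j, G j)) (j : ι) :
    PontryaginDual.map (inclusion G j) χ = (dualPi G).symm χ j :=
  rfl

end Rider

end

theorem theorem6p1 {m : ℕ} (hm : 2 ≤ m) (G : Fin m → Type*) [∀ j, CommGroup (G j)]
    [∀ j, TopologicalSpace (G j)] [∀ j, IsTopologicalGroup (G j)] [∀ j, CompactSpace (G j)]
    [∀ j, T2Space (G j)] (p : Fin m → ℝ) (Λ : ∀ j, Set (PontryaginDual (G j)))
    (hΛ : ∀ j, Rider.IsRider (p j) (Λ j)) (q R : ℝ)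
    (hR : R = ∑ k, p k / (2 - p k)) (hq : 1 / q = 1 / 2 + 1 / (2 * R)) :
    Rider.IsRider q (Rider.prodSet Λ) := by
  classical
  have hp1 : ∀ j, 1 ≤ p j := fun j => (hΛ j).1
  have hp2 : ∀ j, p j < 2 := fun j => (hΛ j).2.1
  -- `q ≥ 1` amounts to `R ≥ 1`; each summand of `R` is at least 1 because `p j ≥ 1`.
  have hR1 : 1 ≤ R := by
    have hterm : ∀ j, 1 ≤ p j / (2 - p j) := fun j => by
      have := hp1 j
      have := hp2 j
      rw [le_div_iff₀ (by linarith)]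
      linarith
    have hsum : ∑ _k : Fin m, (1 : ℝ) ≤ R := hR ▸ Finset.sum_le_sum fun j _ => hterm j
    have hm' : (2 : ℝ) ≤ m := by exact_mod_cast hm
    simp only [Finset.sum_const, Finset.card_univ, Fintype.card_fin, nsmul_eq_mul, mul_one] at hsum
    linarith
  have hqR : q = 2 * R / (R + 1) := by
    rw [← one_div_one_div q, hq]
    field_simp
  have hq1 : 1 ≤ q := by
    rw [hqR, le_div_iff₀ (by linarith)]
    linarith
  have hq2 : q < 2 := by
    rw [hqR, div_lt_iff₀ (by linarith)]
    linarith
  choose κ hκ hκΛ using fun j => (hΛ j).2.2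
  let : MeasurableSpace (∀ j, G j) := borel _
  have : BorelSpace (∀ j, G j) := ⟨rfl⟩
  have : Nonempty (Fin m) := ⟨⟨0, by omega⟩⟩
  have hC : 0 < 2 * ∑ j, κ j :=
    mul_pos two_pos (Finset.sum_pos (fun j _ => hκ j) Finset.univ_nonempty)
  refine ⟨hq1, hq2, 2 * ∑ j, κ j, hC, fun f hf => ?_⟩
  -- The slack `δ` keeps the bound positive, as the normalization in the Blei-type inequality
  -- requires, even if `⟦f⟧ = 0`.
  refine ENNReal.le_of_forall_pos_le_add fun δ hδ hfin => ?_
  set B := ENNReal.ofReal (2 * ∑ j, κ j) * Rider.randomNorm f with hB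
  have hK : 0 < B.toReal + δ := add_pos_of_nonneg_of_pos ENNReal.toReal_nonneg (by exact_mod_cast hδ)
  have hBK : ENNReal.ofReal (B.toReal + δ) = B + δ := by
    rw [ENNReal.ofReal_add ENNReal.toReal_nonneg δ.coe_nonneg, ENNReal.ofReal_toReal hfin.ne,
      ENNReal.ofReal_coe_nnreal]
  rw [← hBK]
  refine Rider.coeffNorm_le_ofReal f (by linarith) hK.le fun A hA => ?_
  refine Rider.sum_rpow_le_of_mixed_norms A
    (fun j χ => PontryaginDual.map (Rider.inclusion G j) χ) (Rider.dualPi G).symm.injective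
    (fun χ => ‖Rider.fourierCoeff f χ‖) (fun χ => norm_nonneg _) p hp1 hp2 (by linarith) hR hqR hK
    fun j => ?_
  have hpj : 0 < p j := by linarith [hp1 j]
  let : MeasurableSpace (G j) := borel _
  have : BorelSpace (G j) := ⟨rfl⟩
  have hmix := Rider.ofReal_mixed_norm_le (Rider.inclusion G j) (hp1 j) (hκΛ j) f A fun χ hχ => by
    obtain ⟨γ, hγ, rfl⟩ : χ ∈ Rider.prodSet Λ := by
      by_contra h
      exact hA χ hχ (hf χ h)
    rw [Rider.map_inclusion, MulEquiv.symm_apply_apply]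
    exact hγ j (Set.mem_univ j)
  -- The sum of the `κ j` dominates each of them, so one bound serves every coordinate.
  have hle : 2 * (ENNReal.ofReal (κ j) * Rider.randomNorm f) ≤
      ENNReal.ofReal (B.toReal + δ) := by
    rw [hBK, ← mul_assoc, ← ENNReal.ofReal_ofNat, ← ENNReal.ofReal_mul zero_le_two]
    refine le_add_right (mul_le_mul_left (ENNReal.ofReal_le_ofReal ?_) _)
    exact mul_le_mul_of_nonneg_left
      (Finset.single_le_sum (fun i _ => (hκ i).le) (Finset.mem_univ j)) zero_le_two
  have hreal := (ENNReal.ofReal_le_ofReal_iff hK.le).1 (hmix.trans hle)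
  exact (Real.rpow_inv_le_iff_of_pos (by positivity) hK.le hpj).1 (by simpa only [one_div] using hreal)
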